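/- Let $N_w,N_b>0$ and $\delta\in(0,1)$. Alice transmits words $\mathbf x\in\mathbb R^n$. Bob observes $\mathbf Y=\mathbf x+\mathbf B$, where $\mathbf B$ has i.i.d. $\mathcal N(0,N_b/2)$ entries, and Willie observes $\mathbf Z=\mathbf x+\mathbf W$, where $\mathbf W$ has i.i.d. $\mathcal N(0,N_w/2)$ entries. A code of blocklength $n$ consists of integers $M,K\ge 1$, codewords $\mathbf x_{ms}\in\mathbb R^n$ for $1\le m\le M$ and $1\le s\le K$, and a decoder $\Gamma$ that maps Bob's observation and the key $s$ to $\widehat m\in\{0,1,\dots,M\}$. The key $S$ is uniform on $\{1,\dots,K\}$ and is shared by Alice and Bob. When Alice is silent she sends $\mathbf x=\mathbf 0$ (message $0$). When she is active she sends $\mathbf x_{mS}$ with $m$ uniform on $\{1,\dots,M\}$, independent of $S$. The error probability of the code is $$P_{\mathrm{err}}=\max_{1\le s\le K}\frac1M\sum_{m=1}^M\Pr\big(\Gamma(\mathbf x_{ms}+\mathbf B,s)\ne m\big)+\frac1K\sum_{s=1}^K\Pr\big(\Gamma(\mathbf B,s)\ne 0\big).$$ Let $W^{\otimes n}(\mathbf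 z|\mathbf x)=\prod_{i=1}^n\frac1{\sqrt{\pi N_w}}e^{-(z_i-x_i)^2/N_w}$ be the density of Willie's observation when $\mathbf x$ is sent. Let $\widehat Q(\mathbf z)=\frac1{MK}\sum_{m=1}^M\sum_{s=1}^K W^{\otimes n}(\mathbf z|\mathbf x_{ms})$ and $Q_0^{\otimes n}(\mathbf z)=W^{\otimes n}(\mathbf z|\mathbf 0)$ be its densities when Alice is active and silent, respectively, and let $\mathbb V(P,P')=\frac12\int_{\mathbb R^n}|P(\mathbf z)-P'(\mathbf z)|\,d\mathbf z$ be the variational distance. Let $Q^{-1}$ be the inverse of the Gaussian tail function $Q(\lambda)=\frac1{\sqrt{2\pi}}\int_\lambda^\infty e^{-u^2/2}\,du$. Theorem. For every sequence of codes, one of each blocklength $n$, such that $\lim_{n\to\infty}P_{\mathrm{err}}=0$ and $\limsup_{n\to\infty}\mathbb V(\widehat Q,Q_0^{\otimes n})\le\delta$, $$\limsup_{n\to\infty}\frac{\log M}{\sqrt n}\le\frac{\sqrt2\,N_w}{N_b}\,Q^{-1}\Big(\frac{1-\delta}2\Big),$$ where $\log$ is the natural logarithm. -/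

import Mathlib

noncomputable section

namespace CovertGaussian

/-- The tail function of the standard normal distribution. -/
def Q (t : ℝ) : ℝ :=
  (1 / Real.sqrt (2 * Real.pi)) * ∫ u in Set.Ioi t, Real.exp (-u ^ 2 / 2)

/-- The inverse of the strictly decreasing function `Q : ℝ → (0, 1)`; only its values at
arguments in `(0, 1)` are meaningful. -/
def Qinv (p : ℝ) : ℝ := Function.invFun Q p

/-- Density of the output of `n` uses of the channel `z = x + noise` with i.i.d. noise of law
`𝒩(0, N / 2)`, when the input word is `x`. -/
def channelDensity (N : ℝ) {n : ℕ} (x z : Fin n → ℝ) : ℝ :=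
  ∏ i, ProbabilityTheory.gaussianPDFReal (x i) (N / 2).toNNReal (z i)

/-- Law of the output of `n` uses of the channel `y = x + noise` with i.i.d. noise of law
`𝒩(0, N / 2)`, when the input word is `x`. -/
def channelLaw (N : ℝ) {n : ℕ} (x : Fin n → ℝ) : MeasureTheory.Measure (Fin n → ℝ) :=
  MeasureTheory.Measure.pi fun i => ProbabilityTheory.gaussianReal (x i) (N / 2).toNNReal

/-- The variational distance of two probability densities on `ℝⁿ`. -/
def variationalDistance {n : ℕ} (p q : (Fin n → ℝ) → ℝ) : ℝ :=
  (1 / 2) * ∫ z, |p z - q z|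

/-- A keyed code of blocklength `n`, with `M` messages and `K` keys. A pair of a message and a key
is encoded as a real word of length `n`; the silent transmitter sends the zero word.
The decoder sees the channel output and the key. Its value `0` means
"no transmission", and its value `m.succ` means "message `m`". -/
structure Code (n : ℕ) where
  M : ℕ
  K : ℕ
  M_pos : 0 < M
  K_pos : 0 < K
  encode : Fin M → Fin K → (Fin n → ℝ)
  decode : (Fin n → ℝ) → Fin K → Fin (M + 1)
  measurable_decode : ∀ s, Measurable fun y => decode y s

namespace Code

variable {n : ℕ} (C : Code n)

/-- Probability that the message is not recovered, given that the transmitter is active (the message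
is then uniformly distributed) and that the key is `s`. -/
def activeError (Nb : ℝ) (s : Fin C.K) : ℝ :=
  (1 / (C.M : ℝ)) * ∑ m, (channelLaw Nb (C.encode m s)).real {y | C.decode y s ≠ m.succ}

/-- Probability that the decoder does not output `0`, given that the transmitter is silent
(the key is uniformly distributed). -/
def silentError (Nb : ℝ) : ℝ :=
  (1 / (C.K : ℝ)) * ∑ s, (channelLaw Nb (0 : Fin n → ℝ)).real {y | C.decode y s ≠ 0}

/-- The error probability of the code: the maximum over the keys of the average error
when active, plus the error when silent. -/
def errorProb (Nb : ℝ) : ℝ :=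
  (⨆ s, C.activeError Nb s) + C.silentError Nb

/-- Density of the warden's observation when the transmitter is active. -/
def activeDensity (Nw : ℝ) (z : Fin n → ℝ) : ℝ :=
  (1 / ((C.M : ℝ) * (C.K : ℝ))) * ∑ m, ∑ s, channelDensity Nw (C.encode m s) z

/-- Variational distance between the laws of the warden's observation when the transmitter is active
and when it is silent. -/
def wardenDistance (Nw : ℝ) : ℝ :=
  variationalDistance (C.activeDensity Nw) (channelDensity Nw 0)

end Code

end CovertGaussian

end

open MeasureTheory ProbabilityTheory Filter Topology

namespace CovertGaussian

/-! Covertness limits codeword energy, and low energy limits the number of messages. Let Willie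
threshold `∑ z_i²` at `n N_w/2 + τ√n`, with `τ = r₀ N_w/√2`. By the central limit theorem his
false-alarm probability tends to `Q r₀`. A word of energy at least `β√n`, `β > 2τ`, raises the
statistic by more than `2τ√n`, up to a cross term of order smaller than the energy, so it is
detected with probability at least `1 - Q r₀ - o(1)` (`highEnergy_le_of_high_power`). For `r₀ >
Q⁻¹((1-δ)/2)` this gap `1 - 2 Q r₀` exceeds `δ`, hence a fixed fraction `f` of the codewords has
energy at most `√2 N_w r √n`, for any `r > r₀` (`exists_eventually_le_lowPowerFraction`). Some key
inherits this fraction. For Bob, a change of measure to the zero input costs a factor of about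
`exp(P/N_b)` for words of energy at most `P`. The decoding regions are disjoint, so their
probabilities under the zero input sum to at most one, which gives `log M ≤ P/N_b + o(√n)`
(`Code.log_M_le`). -/

/-! ### The Gaussian channel -/

instance isProbabilityMeasure_channelLaw (N : ℝ) {n : ℕ} (x : Fin n → ℝ) :
    IsProbabilityMeasure (channelLaw N x) := by
  unfold channelLaw; infer_instance

lemma toNNReal_half_ne_zero {N : ℝ} (hN : 0 < N) : (N / 2).toNNReal ≠ 0 := by
  simpa using hN

lemma channelDensity_nonneg (N : ℝ) {n : ℕ} (x z : Fin n → ℝ) : 0 ≤ channelDensity N x z :=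
  Finset.prod_nonneg fun _ _ => gaussianPDFReal_nonneg _ _ _

lemma integrable_channelDensity (N : ℝ) {n : ℕ} (x : Fin n → ℝ) :
    Integrable (channelDensity N x) :=
  Integrable.fintype_prod (f := fun i t => gaussianPDFReal (x i) (N / 2).toNNReal t)
    fun _ => integrable_gaussianPDFReal _ _

lemma channelLaw_eq_withDensity {N : ℝ} (hN : 0 < N) {n : ℕ} (x : Fin n → ℝ) :
    channelLaw N x = volume.withDensity fun z => ENNReal.ofReal (channelDensity N x z) := by
  have hv := toNNReal_half_ne_zero hN
  refine Measure.pi_eq fun s hs => ?_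
  rw [withDensity_apply _ (.univ_pi hs), ← ofReal_integral_eq_lintegral_ofReal
    (integrable_channelDensity N x).integrableOn (ae_of_all _ (channelDensity_nonneg N x)),
    volume_pi, Measure.restrict_pi_pi]
  simp only [channelDensity]
  rw [integral_fintype_prod_eq_prod (fun i t => gaussianPDFReal (x i) (N / 2).toNNReal t),
    ENNReal.ofReal_prod_of_nonneg
      fun i _ => integral_nonneg fun _ => gaussianPDFReal_nonneg _ _ _]
  simp_rw [gaussianReal_apply_eq_integral _ hv]

lemma channelLaw_real_eq_setIntegral {N : ℝ} (hN : 0 < N) {n : ℕ} (x : Fin n → ℝ)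
    {A : Set (Fin n → ℝ)} (hA : MeasurableSet A) :
    (channelLaw N x).real A = ∫ z in A, channelDensity N x z := by
  rw [measureReal_def, channelLaw_eq_withDensity hN, withDensity_apply _ hA,
    ← ofReal_integral_eq_lintegral_ofReal
    (integrable_channelDensity N x).integrableOn (ae_of_all _ (channelDensity_nonneg N x)),
    ENNReal.toReal_ofReal (integral_nonneg (channelDensity_nonneg N x))]

lemma channelLaw_eq_map_add (N : ℝ) {n : ℕ} (x : Fin n → ℝ) :
    channelLaw N x = (channelLaw N 0).map fun w => x + w := by
  have := Measure.pi_map_pi (μ := fun i : Fin n => gaussianReal ((0 : Fin n → ℝ) i) (N / 2).toNNReal)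
    (f := fun i t => x i + t) fun i => by fun_prop
  simp only [gaussianReal_map_const_add] at this
  unfold channelLaw
  change _ = Measure.map (fun (w : Fin n → ℝ) i => x i + w i) _
  rw [this]
  simp

lemma channelLaw_real_eq_preimage (N : ℝ) {n : ℕ} (x : Fin n → ℝ)
    {A : Set (Fin n → ℝ)} (hA : MeasurableSet A) :
    (channelLaw N x).real A = (channelLaw N 0).real {w | x + w ∈ A} := by
  rw [channelLaw_eq_map_add, map_measureReal_apply (by fun_prop) hA]
  rfl

/-- Chebyshev's inequality for a linear functional of the noise. -/
lemma channelLaw_zero_abs_sum_mul_ge_le {N : ℝ} (hN : 0 < N) {n : ℕ} (x : Fin n → ℝ) {t : ℝ}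
    (ht : 0 < t) :
    (channelLaw N (0 : Fin n → ℝ)).real {w | t ≤ |∑ i, x i * w i|}
      ≤ N / 2 * (∑ i, x i ^ 2) / t ^ 2 := by
  have hmem : ∀ i : Fin n,
      MemLp (fun u => x i * u) 2 (gaussianReal ((0 : Fin n → ℝ) i) (N / 2).toNNReal) := fun i =>
    (memLp_id_gaussianReal' 2 (by simp)).const_mul (x i)
  have hmemsum : MemLp (∑ i, fun w : Fin n → ℝ => x i * w i) 2 (channelLaw N 0) :=
    memLp_finsetSum' _ fun i _ => (hmem i).comp_measurePreserving (measurePreserving_eval _ i)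
  have hvar : Var[∑ i, fun w : Fin n → ℝ => x i * w i; channelLaw N 0]
      = N / 2 * ∑ i, x i ^ 2 := by
    unfold channelLaw
    rw [variance_sum_pi hmem, Finset.mul_sum]
    refine Finset.sum_congr rfl fun i _ => ?_
    rw [variance_const_mul, variance_fun_id_gaussianReal, Real.coe_toNNReal _ (by positivity)]
    ring
  have hmean : (channelLaw N 0)[∑ i, fun w : Fin n → ℝ => x i * w i] = 0 := by
    simp only [Finset.sum_apply]
    rw [integral_finsetSum]
    · refine Finset.sum_eq_zero fun i _ => ?_
      rw [integral_const_mul]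
      unfold channelLaw
      rw [integral_eval]
      simp
    · exact fun i _ => ((hmem i).comp_measurePreserving
        (measurePreserving_eval _ i)).integrable (by norm_num)
  have := meas_ge_le_variance_div_sq hmemsum ht
  rw [hmean, hvar] at this
  simp only [sub_zero, Finset.sum_apply] at this
  exact ENNReal.toReal_le_of_le_ofReal (by positivity) this

/-! ### Likelihood ratio against the zero word -/

lemma channelDensity_eq_exp_mul {N : ℝ} (hN : 0 < N) {n : ℕ} (x z : Fin n → ℝ) :
    channelDensity N x z
      = Real.exp ((2 * ∑ i, x i * z i - ∑ i, x i ^ 2) / N) * channelDensity N 0 z := by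
  have : (2 * ∑ i, x i * z i - ∑ i, x i ^ 2) / N = ∑ i, (2 * (x i * z i) - x i ^ 2) / N := by
    rw [← Finset.sum_div, Finset.sum_sub_distrib, Finset.mul_sum]
  unfold channelDensity
  rw [this, Real.exp_sum, ← Finset.prod_mul_distrib]
  refine Finset.prod_congr rfl fun i _ => ?_
  simp only [gaussianPDFReal_def, Real.coe_toNNReal _ (half_pos hN).le, Pi.zero_apply]
  rw [mul_left_comm, ← Real.exp_add]
  congr 2
  field_simp
  ring

/-- Change of measure: a set that has probability at least `1 / 2` when a word of low power is sent
cannot be too improbable when the zero word is sent. -/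
lemma exp_le_channelLaw_zero_real {N : ℝ} (hN : 0 < N) {n : ℕ} {x : Fin n → ℝ} {P t : ℝ}
    (hP : ∑ i, x i ^ 2 ≤ P) (ht : 0 < t) (hPt : 2 * P / (N * t ^ 2) ≤ 1 / 4)
    {D : Set (Fin n → ℝ)} (hD : MeasurableSet D) (hxD : 1 / 2 ≤ (channelLaw N x).real D) :
    1 / 4 * Real.exp (-(P / N + t)) ≤ (channelLaw N 0).real D := by
  set p := ∑ i, x i ^ 2 with hp
  -- On `L` the log-likelihood ratio is at most `P/N + t`. When `x` is sent, leaving `L` forces `∑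
  -- x_i w_i > N t / 2`, because `p ≤ P`.
  set L : Set (Fin n → ℝ) := {z | 2 * ∑ i, x i * z i - p ≤ N * (P / N + t)} with hL
  have hLm : MeasurableSet L := measurableSet_le (by fun_prop) (by fun_prop)
  have hLc : (channelLaw N x).real Lᶜ ≤ 1 / 4 := by
    rw [channelLaw_real_eq_preimage N x hLm.compl]
    calc (channelLaw N 0).real {w | x + w ∈ Lᶜ}
        ≤ (channelLaw N 0).real {w | N * t / 2 ≤ |∑ i, x i * w i|} := by
          refine measureReal_mono fun w hw => ?_
          simp only [hL, Set.mem_compl_iff, Set.mem_ofPred_eq, not_le, Pi.add_apply, mul_add,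
            Finset.sum_add_distrib, mul_div_cancel₀ _ hN.ne'] at hw ⊢
          simp only [← pow_two, ← hp] at hw
          exact le_trans (by linarith) (le_abs_self _)
      _ ≤ N / 2 * p / (N * t / 2) ^ 2 := channelLaw_zero_abs_sum_mul_ge_le hN x (by positivity)
      _ = 2 * p / (N * t ^ 2) := by field_simp
      _ ≤ 2 * P / (N * t ^ 2) := by gcongr
      _ ≤ 1 / 4 := hPt
  have hDL : 1 / 4 ≤ (channelLaw N x).real (D ∩ L) := by
    have h1 : (channelLaw N x).real D ≤
        (channelLaw N x).real (D ∩ L) + (channelLaw N x).real Lᶜ := by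
      refine (measureReal_mono fun z hz => ?_).trans (measureReal_union_le _ _)
      by_cases h : z ∈ L
      · exact Or.inl ⟨hz, h⟩
      · exact Or.inr h
    linarith
  have hcm : (channelLaw N x).real (D ∩ L)
      ≤ Real.exp (P / N + t) * (channelLaw N 0).real (D ∩ L) := by
    rw [channelLaw_real_eq_setIntegral hN x (hD.inter hLm),
      channelLaw_real_eq_setIntegral hN 0 (hD.inter hLm), ← integral_const_mul]
    refine setIntegral_mono_on (integrable_channelDensity N x).integrableOn
      ((integrable_channelDensity N 0).const_mul _).integrableOn (hD.inter hLm) fun z hz => ?_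
    rw [channelDensity_eq_exp_mul hN]
    refine mul_le_mul_of_nonneg_right (Real.exp_le_exp.2 ?_) (channelDensity_nonneg N 0 z)
    rw [div_le_iff₀ hN, mul_comm (P / N + t)]
    exact hz.2
  have hmono : (channelLaw N 0).real (D ∩ L) ≤ (channelLaw N 0).real D :=
    measureReal_mono Set.inter_subset_left
  rw [Real.exp_neg, ← div_eq_mul_inv, div_le_iff₀ (Real.exp_pos _)]
  calc (1 / 4 : ℝ) ≤ Real.exp (P / N + t) * (channelLaw N 0).real (D ∩ L) := hDL.trans hcm
    _ ≤ _ := by rw [mul_comm]; gcongr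

/-! ### The Gaussian tail function -/

lemma Q_eq_gaussianReal (t : ℝ) : Q t = (gaussianReal 0 1).real (Set.Ioi t) := by
  rw [measureReal_def, gaussianReal_apply_eq_integral _ one_ne_zero,
    ENNReal.toReal_ofReal (integral_nonneg fun _ => gaussianPDFReal_nonneg _ _ _), Q,
    ← integral_const_mul]
  simp [gaussianPDFReal_def]

lemma gaussianReal_map_sqrt_mul (v : NNReal) :
    (gaussianReal 0 1).map (fun u => √(v : ℝ) * u) = gaussianReal 0 v := by
  rw [gaussianReal_map_const_mul, mul_zero]
  congr 1
  ext
  simp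

lemma gaussianReal_real_Ioi {v : NNReal} (hv : v ≠ 0) (t : ℝ) :
    (gaussianReal 0 v).real (Set.Ioi t) = Q (t / √v) := by
  have hs : 0 < √(v : ℝ) := Real.sqrt_pos.2 (NNReal.coe_pos.2 (pos_iff_ne_zero.2 hv))
  rw [← gaussianReal_map_sqrt_mul v, map_measureReal_apply (by fun_prop) measurableSet_Ioi, Q_eq_gaussianReal]
  congr 1
  ext u
  simp [div_lt_iff₀' hs]

lemma Q_strictAnti : StrictAnti Q := by
  intro s t hst
  rw [Q_eq_gaussianReal, Q_eq_gaussianReal]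
  have hsplit : (gaussianReal 0 1).real (Set.Ioi s)
      = (gaussianReal 0 1).real (Set.Ioc s t) + (gaussianReal 0 1).real (Set.Ioi t) := by
    rw [← Set.Ioc_union_Ioi_eq_Ioi hst.le]
    exact measureReal_union (Set.disjoint_left.2 fun x hx hx' => not_lt.2 hx.2 hx')
      measurableSet_Ioi
  have hpos : 0 < (gaussianReal 0 1).real (Set.Ioc s t) := by
    refine ENNReal.toReal_pos (fun h => ?_) (measure_ne_top _ _)
    have := gaussianReal_absolutelyContinuous' 0 (v := 1) one_ne_zero h
    simp [hst.not_ge] at this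
  linarith

lemma Q_neg (t : ℝ) : Q (-t) = 1 - Q t := by
  have : NullSingletonClass (gaussianReal 0 1) := nullSingletonClass_gaussianReal one_ne_zero
  rw [Q_eq_gaussianReal, Q_eq_gaussianReal, ← probReal_compl_eq_one_sub measurableSet_Ioi,
    Set.compl_Ioi]
  conv_lhs => rw [← neg_zero, ← gaussianReal_map_neg, map_measureReal_apply (by fun_prop)
    measurableSet_Ioi]
  rw [measureReal_def, measureReal_def, ← measure_congr Iio_ae_eq_Iic]
  congr 2
  ext; simp

lemma Q_surjOn : Set.SurjOn Q Set.univ (Set.Ioo 0 1) := by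
  have : NullSingletonClass (gaussianReal 0 1) := nullSingletonClass_gaussianReal one_ne_zero
  have hQ : Q = fun t => 1 - cdf (gaussianReal 0 1) t := by
    ext t
    rw [cdf_eq_real, Q_eq_gaussianReal, ← Set.compl_Iic,
      probReal_compl_eq_one_sub measurableSet_Iic]
  have hcont : Continuous Q := by
    refine continuous_iff_continuousAt.2 fun t => ?_
    have hint : Integrable fun u : ℝ => Real.exp (-u ^ 2 / 2) := by
      refine (integrable_exp_neg_mul_sq (b := 1 / 2) (by norm_num)).congr (ae_of_all _ fun u => ?_)
      ring_nf
    exact ((hint.integrableOn.continuousOn_Ici_primitive_Ioi (a₀ := t - 1)).continuousAt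
      (Ici_mem_nhds (by linarith))).const_mul _
  have htop : Tendsto Q atTop (𝓝 0) := by
    rw [hQ]; simpa using (tendsto_cdf_atTop (gaussianReal 0 1)).const_sub 1
  have hbot : Tendsto Q atBot (𝓝 1) := by
    rw [hQ]; simpa using (tendsto_cdf_atBot (gaussianReal 0 1)).const_sub 1
  rintro p ⟨hp0, hp1⟩
  obtain ⟨a, ha⟩ := (hbot.eventually (lt_mem_nhds hp1)).exists
  obtain ⟨b, hb⟩ := (htop.eventually (gt_mem_nhds hp0)).exists
  obtain ⟨c, hc⟩ := mem_range_of_exists_le_of_exists_ge hcont ⟨b, hb.le⟩ ⟨a, ha.le⟩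
  exact ⟨c, trivial, hc⟩

lemma Q_Qinv {p : ℝ} (hp : p ∈ Set.Ioo (0 : ℝ) 1) : Q (Qinv p) = p :=
  Function.invFun_eq (by obtain ⟨t, -, ht⟩ := Q_surjOn hp; exact ⟨t, ht⟩)

/-! ### Fluctuations of the noise energy -/

lemma integral_pow_four_gaussianReal (v : NNReal) :
    ∫ x, x ^ 4 ∂(gaussianReal 0 v) = 3 * (v : ℝ) ^ 2 := by
  have hstd : ∫ x, x ^ 4 ∂(gaussianReal 0 1) = 3 := by
    rw [integral_gaussianReal_eq_integral_smul one_ne_zero]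
    have h1 : ∀ x : ℝ, gaussianPDFReal 0 1 x • x ^ 4
        = (√(2 * Real.pi))⁻¹ * (|x| ^ (4 : ℝ) * Real.exp (-(1 / 2) * |x| ^ (2 : ℝ))) := by
      intro x
      have h4 : |x| ^ (4 : ℝ) = x ^ 4 := by
        rw [show (4 : ℝ) = ((4 : ℕ) : ℝ) by norm_num, Real.rpow_natCast]
        exact Even.pow_abs (by decide) x
      have h2 : |x| ^ (2 : ℝ) = x ^ 2 := by
        rw [show (2 : ℝ) = ((2 : ℕ) : ℝ) by norm_num, Real.rpow_natCast, sq_abs]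
      rw [h4, h2, gaussianPDFReal_def]
      simp
      ring_nf
    simp_rw [h1]
    rw [integral_const_mul, integral_comp_abs
      (f := fun y => y ^ (4 : ℝ) * Real.exp (-(1 / 2) * y ^ (2 : ℝ))),
      integral_rpow_mul_exp_neg_mul_rpow (by norm_num) (by norm_num) (by norm_num)]
    have hG : Real.Gamma ((4 + 1) / 2) = 3 / 4 * √Real.pi := by
      rw [show ((4 : ℝ) + 1) / 2 = (1 / 2 + 1) + 1 by norm_num, Real.Gamma_add_one (by norm_num),
        Real.Gamma_add_one (by norm_num), Real.Gamma_one_half_eq]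
      ring
    have hpow : (1 / 2 : ℝ) ^ (-(4 + 1) / 2 : ℝ) = 4 * √2 := by
      rw [one_div, Real.inv_rpow (by norm_num), ← Real.rpow_neg (by norm_num),
        show (-(-(4 + 1) / 2 : ℝ)) = 2 + 1 / 2 by norm_num, Real.rpow_add (by norm_num),
        ← Real.sqrt_eq_rpow]
      norm_num
    rw [hG, hpow, Real.sqrt_mul (by norm_num)]
    have : √Real.pi ≠ 0 := (Real.sqrt_pos.2 Real.pi_pos).ne'
    field_simp
  rw [← gaussianReal_map_sqrt_mul v, integral_map (by fun_prop) (by fun_prop)]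
  simp_rw [mul_pow]
  rw [integral_const_mul, hstd, show √(v : ℝ) ^ 4 = (√(v : ℝ) ^ 2) ^ 2 by ring,
    Real.sq_sqrt v.coe_nonneg]
  ring

lemma integral_sq_gaussianReal (v : NNReal) : ∫ x, x ^ 2 ∂(gaussianReal 0 v) = v := by
  have := variance_eq_sub (memLp_id_gaussianReal' (μ := 0) (v := v) 2 (by simp))
  rw [variance_id_gaussianReal] at this
  simpa using this.symm

lemma memLp_sq_gaussianReal (v : NNReal) : MemLp (fun x => x ^ 2) 2 (gaussianReal 0 v) := by
  refine (memLp_two_iff_integrable_sq (by fun_prop)).2 ?_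
  have := (memLp_id_gaussianReal' (μ := 0) (v := v) 4 (by simp)).integrable_norm_pow (by norm_num)
  refine this.congr (ae_of_all _ fun x => ?_)
  simp only [id, Real.norm_eq_abs, Even.pow_abs (by decide : Even 4)]
  ring

lemma variance_sq_gaussianReal (v : NNReal) :
    Var[fun x => x ^ 2; gaussianReal 0 v] = 2 * (v : ℝ) ^ 2 := by
  rw [variance_eq_sub (memLp_sq_gaussianReal v), integral_sq_gaussianReal]
  have : ∫ x, ((fun x : ℝ => x ^ 2) ^ 2) x ∂(gaussianReal 0 v) = 3 * (v : ℝ) ^ 2 := by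
    rw [← integral_pow_four_gaussianReal]
    congr with x
    simp only [Pi.pow_apply]; ring
  rw [this]; ring

/-- Central limit theorem for the energy of the noise. -/
lemma tendsto_channelLaw_zero_real_energy_gt {N : ℝ} (hN : 0 < N) (τ : ℝ) :
    Tendsto (fun n : ℕ => (channelLaw N (0 : Fin n → ℝ)).real
      {w | n * (N / 2) + τ * √n < ∑ i, w i ^ 2}) atTop (𝓝 (Q (τ / (√2 * (N / 2))))) := by
  set v := (N / 2).toNNReal with hvdef
  have hv : v ≠ 0 := toNNReal_half_ne_zero hN
  have hvN : (v : ℝ) = N / 2 := Real.coe_toNNReal _ (by positivity)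
  -- The central limit theorem needs one probability space for all `n`; `channelLaw N 0` is the law
  -- of the first `n` coordinates.
  let P : Measure (ℕ → ℝ) := Measure.infinitePi fun _ => gaussianReal 0 v
  let X : ℕ → (ℕ → ℝ) → ℝ := fun i ω => ω i ^ 2
  have hmap (i : ℕ) : P.map (fun ω => ω i) = gaussianReal 0 v :=
    Measure.infinitePi_map_eval (fun _ => gaussianReal 0 v) i
  have hev (i : ℕ) : AEMeasurable (fun ω : ℕ → ℝ => ω i) P := (measurable_pi_apply i).aemeasurable
  have hmapX (i : ℕ) : P.map (X i) = (gaussianReal 0 v).map (fun x => x ^ 2) := by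
    rw [← hmap i, Measure.map_map (by fun_prop) (by fun_prop)]; rfl
  have hvar : Var[X 0; P] = 2 * (v : ℝ) ^ 2 := by
    rw [← variance_sq_gaussianReal, ← hmap 0, variance_map (by fun_prop) (hev 0)]; rfl
  have hmean : P[X 0] = (v : ℝ) := by
    rw [← integral_sq_gaussianReal v, ← hmap 0, integral_map (hev 0) (by fun_prop)]
  have hLp : MemLp (X 0) 2 P :=
    (hmap 0 ▸ memLp_sq_gaussianReal v).comp_of_map (hev 0)
  have hindep : iIndepFun X P :=
    iIndepFun_infinitePi (X := fun _ x => x ^ 2) (fun _ => by fun_prop)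
  have hident (i : ℕ) : IdentDistrib (X i) (X 0) P P :=
    ⟨by fun_prop, by fun_prop, by rw [hmapX, hmapX]⟩
  have hclt := (tendstoInDistribution_inv_sqrt_mul_sum_sub
    (P' := gaussianReal 0 Var[X 0; P].toNNReal) (Y := id) HasLaw.id hLp hindep hident).tendsto
  have hV : Var[X 0; P].toNNReal ≠ 0 := by
    have hv' : (0 : ℝ) < v := NNReal.coe_pos.2 (pos_iff_ne_zero.2 hv)
    rw [hvar]
    exact (Real.toNNReal_pos.2 (by positivity)).ne'
  have hfr : ((gaussianReal 0 Var[X 0; P].toNNReal).map id) (frontier (Set.Ioi τ)) = 0 := by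
    have : NullSingletonClass (gaussianReal 0 Var[X 0; P].toNNReal) :=
      nullSingletonClass_gaussianReal hV
    rw [frontier_Ioi, Measure.map_id]
    simp
  have h1 := ProbabilityMeasure.tendsto_measure_of_null_frontier_of_tendsto' hclt hfr
  have hne : ((gaussianReal 0 Var[X 0; P].toNNReal).map id) (Set.Ioi τ) ≠ ⊤ := by
    rw [Measure.map_id]
    exact measure_ne_top _ _
  have h2 := (ENNReal.tendsto_toReal hne).comp h1
  have hlim : (((gaussianReal 0 Var[X 0; P].toNNReal).map id) (Set.Ioi τ)).toReal
      = Q (τ / (√2 * (N / 2))) := by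
    rw [Measure.map_id]
    have := gaussianReal_real_Ioi hV τ
    rw [measureReal_def] at this
    rw [this, hvar, hvN, Real.coe_toNNReal _ (by positivity), Real.sqrt_mul (by norm_num),
      Real.sqrt_sq (by positivity)]
  change Tendsto _ _ (𝓝 ((((gaussianReal 0 Var[X 0; P].toNNReal).map id) (Set.Ioi τ)).toReal)) at h2
  rw [hlim] at h2
  refine h2.congr' ?_
  filter_upwards [eventually_gt_atTop 0] with n hn
  have hs : 0 < √(n : ℝ) := Real.sqrt_pos.2 (Nat.cast_pos.2 hn)
  have hfin : channelLaw N (0 : Fin n → ℝ) = P.map (fun ω (i : Fin n) => ω i) := by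
    have := Measure.map_infinitePi_infinitePi_of_inj (P := fun _ : ℕ => gaussianReal 0 v)
      (f := fun i : Fin n => (i : ℕ)) Fin.val_injective
    rw [this, Measure.infinitePi_eq_pi]
    rfl
  rw [hfin, map_measureReal_apply (by fun_prop) (measurableSet_lt (by fun_prop) (by fun_prop))]
  change (P.map _ (Set.Ioi τ)).toReal = _
  rw [Measure.map_apply (by fun_prop) measurableSet_Ioi, measureReal_def]
  congr 2
  ext ω
  simp only [Set.mem_preimage, Set.mem_Ioi, Set.mem_ofPred_eq, X, hmean, hvN]
  rw [← div_eq_inv_mul, lt_div_iff₀ hs, Fin.sum_univ_eq_sum_range (fun i => ω i ^ 2) n]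
  constructor <;> intro h <;> linarith

/-! ### The energy detector -/

/-- Equal total masses make the excess on `A` cancel the deficit on `Aᶜ`, so each is at most half of
the `L¹` distance. -/
lemma setIntegral_sub_le_variationalDistance {n : ℕ} {p q : (Fin n → ℝ) → ℝ} (hp : Integrable p)
    (hq : Integrable q) (hpq : ∫ z, p z = ∫ z, q z) {A : Set (Fin n → ℝ)} (hA : MeasurableSet A) :
    (∫ z in A, p z) - ∫ z in A, q z ≤ variationalDistance p q := by
  have hd : Integrable fun z => p z - q z := hp.sub hq
  have h0 : (∫ z in A, (p z - q z)) + ∫ z in Aᶜ, (p z - q z) = 0 := by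
    rw [integral_add_compl hA hd, integral_sub hp hq, hpq, sub_self]
  have h1 : ∫ z in A, (p z - q z) ≤ ∫ z in A, |p z - q z| :=
    integral_mono hd.integrableOn hd.abs.integrableOn fun z => le_abs_self _
  have h2 : -(∫ z in Aᶜ, (p z - q z)) ≤ ∫ z in Aᶜ, |p z - q z| := by
    rw [← integral_neg]
    exact integral_mono hd.neg.integrableOn hd.abs.integrableOn fun z => neg_le_abs _
  have h3 := integral_add_compl hA hd.abs
  rw [variationalDistance, ← integral_sub hp.integrableOn hq.integrableOn]
  linarith

/-- The event that the output energy exceeds its mean under silence by more than `τ * √n`. -/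
def highEnergy (N τ : ℝ) (n : ℕ) : Set (Fin n → ℝ) :=
  {z | n * (N / 2) + τ * √n < ∑ i, z i ^ 2}

lemma measurableSet_highEnergy (N τ : ℝ) (n : ℕ) : MeasurableSet (highEnergy N τ n) :=
  measurableSet_lt (by fun_prop) (by fun_prop)

/-- In `∑ (x_i + w_i)² = ∑ w_i² + p + 2 ∑ x_i w_i`, the part `(1 - c) p` of the shift covers the gap
`2τ√n` between the thresholds. The rest, `c p`, absorbs the cross term except on a Chebyshev event
of probability `O(1/p)`. -/
lemma highEnergy_le_of_high_power {N : ℝ} (hN : 0 < N) {n : ℕ} (hn : 0 < n) {x : Fin n → ℝ}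
    {τ β : ℝ} (hτ : 0 < τ) (hτβ : 2 * τ < β) (hx : β * √n ≤ ∑ i, x i ^ 2) :
    (channelLaw N 0).real (highEnergy N (-τ) n) - 2 * N / ((1 - 2 * τ / β) ^ 2 * β * √n)
      ≤ (channelLaw N x).real (highEnergy N τ n) := by
  have hβ : 0 < β := by linarith
  have hs : 0 < √(n : ℝ) := Real.sqrt_pos.2 (Nat.cast_pos.2 hn)
  have hc : 0 < 1 - 2 * τ / β := by rw [sub_pos, div_lt_one hβ]; exact hτβ
  set c := 1 - 2 * τ / β with hcdef
  set p := ∑ i, x i ^ 2 with hp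
  have hp0 : 0 < p := (mul_pos hβ hs).trans_le hx
  have hcp : 2 * τ * √n ≤ (1 - c) * p := by
    have : 2 * τ * √n = (1 - c) * (β * √n) := by rw [hcdef]; field_simp; ring
    rw [this]
    exact mul_le_mul_of_nonneg_left hx (by rw [hcdef]; ring_nf; positivity)
  have hcheb : (channelLaw N 0).real {w : Fin n → ℝ | c * p / 2 ≤ |∑ i, x i * w i|}
      ≤ 2 * N / (c ^ 2 * β * √n) := by
    refine (channelLaw_zero_abs_sum_mul_ge_le hN x (by positivity)).trans ?_
    calc N / 2 * p / (c * p / 2) ^ 2 = 2 * N / (c ^ 2 * p) := by field_simp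
      _ ≤ 2 * N / (c ^ 2 * (β * √n)) := by gcongr
      _ = _ := by rw [mul_assoc]
  have hsub : highEnergy N (-τ) n ⊆
      {w | x + w ∈ highEnergy N τ n} ∪ {w | c * p / 2 ≤ |∑ i, x i * w i|} := by
    intro w hw
    rw [Set.mem_union, or_iff_not_imp_right]
    intro hw'
    simp only [highEnergy, Set.mem_ofPred_eq, not_le, Pi.add_apply, add_sq,
      Finset.sum_add_distrib, mul_assoc, ← Finset.mul_sum, ← hp] at hw hw' ⊢
    have := neg_le_abs (∑ i, x i * w i)
    nlinarith
  have := (measureReal_mono (μ := channelLaw N 0) hsub).trans (measureReal_union_le _ _)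
  rw [channelLaw_real_eq_preimage N x (measurableSet_highEnergy N τ n)]
  linarith

/-! ### Covertness and reliability of a single code -/

namespace Code

variable {n : ℕ} (C : Code n)

/-- The fraction of the codewords whose energy is at most `P`. -/
noncomputable def lowPowerFraction (P : ℝ) : ℝ :=
  1 / ((C.M : ℝ) * C.K) * ∑ m, ∑ s, if ∑ i, C.encode m s i ^ 2 ≤ P then (1 : ℝ) else 0

lemma M_cast_pos : 0 < (C.M : ℝ) := Nat.cast_pos.2 C.M_pos

lemma K_cast_pos : 0 < (C.K : ℝ) := Nat.cast_pos.2 C.K_pos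

lemma integrable_activeDensity (N : ℝ) : Integrable (C.activeDensity N) := by
  unfold activeDensity
  exact (integrable_finsetSum _ fun m _ => integrable_finsetSum _ fun s _ =>
    integrable_channelDensity N _).const_mul _

lemma setIntegral_activeDensity {N : ℝ} (hN : 0 < N) {A : Set (Fin n → ℝ)}
    (hA : MeasurableSet A) :
    ∫ z in A, C.activeDensity N z
      = 1 / ((C.M : ℝ) * C.K) * ∑ m, ∑ s, (channelLaw N (C.encode m s)).real A := by
  unfold activeDensity
  rw [integral_const_mul, integral_finsetSum _ fun m _ => integrable_finsetSum _ fun s _ =>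
    (integrable_channelDensity N _).integrableOn]
  congr 1
  refine Finset.sum_congr rfl fun m _ => ?_
  rw [integral_finsetSum _ fun s _ => (integrable_channelDensity N _).integrableOn]
  exact Finset.sum_congr rfl fun s _ => (channelLaw_real_eq_setIntegral hN _ hA).symm

lemma channelLaw_sub_le_wardenDistance {N : ℝ} (hN : 0 < N) {A : Set (Fin n → ℝ)}
    (hA : MeasurableSet A) :
    1 / ((C.M : ℝ) * C.K) * ∑ m, ∑ s, (channelLaw N (C.encode m s)).real A
      - (channelLaw N 0).real A ≤ C.wardenDistance N := by
  rw [← C.setIntegral_activeDensity hN hA, channelLaw_real_eq_setIntegral hN 0 hA]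
  refine setIntegral_sub_le_variationalDistance (C.integrable_activeDensity N)
    (integrable_channelDensity N 0) ?_ hA
  have h1 := C.setIntegral_activeDensity hN MeasurableSet.univ
  have h2 := channelLaw_real_eq_setIntegral hN (0 : Fin n → ℝ) MeasurableSet.univ
  rw [setIntegral_univ] at h1 h2
  rw [h1, ← h2]
  have := C.M_cast_pos
  have := C.K_cast_pos
  simp
  field_simp

/-- A code that is hard to detect has many codewords of low power. -/
lemma sub_wardenDistance_le_lowPowerFraction {N : ℝ} (hN : 0 < N) (hn : 0 < n)
    {τ β : ℝ} (hτ : 0 < τ) (hτβ : 2 * τ < β) :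
    (channelLaw N 0).real (highEnergy N (-τ) n) - 2 * N / ((1 - 2 * τ / β) ^ 2 * β * √n)
      - (channelLaw N 0).real (highEnergy N τ n) - C.wardenDistance N
      ≤ C.lowPowerFraction (β * √n) := by
  have hβ : 0 < β := by linarith
  set G := (channelLaw N 0).real (highEnergy N (-τ) n)
    - 2 * N / ((1 - 2 * τ / β) ^ 2 * β * √n) with hG
  have hG1 : G ≤ 1 := by
    have h1 : (channelLaw N 0).real (highEnergy N (-τ) n) ≤ 1 := measureReal_le_one
    have h2 : 0 ≤ 2 * N / ((1 - 2 * τ / β) ^ 2 * β * √n) := by positivity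
    linarith
  -- Low-power words need no detection bound: the left side is then `G - 1 ≤ 0`.
  have hpt : ∀ m s, G - (if ∑ i, C.encode m s i ^ 2 ≤ β * √n then (1 : ℝ) else 0)
      ≤ (channelLaw N (C.encode m s)).real (highEnergy N τ n) := by
    intro m s
    split_ifs with h
    · exact (sub_nonpos.2 hG1).trans measureReal_nonneg
    · rw [sub_zero]
      exact highEnergy_le_of_high_power hN hn hτ hτβ (not_le.1 h).le
  have hsum := Finset.sum_le_sum fun m (_ : m ∈ Finset.univ) =>
    Finset.sum_le_sum fun s (_ : s ∈ Finset.univ) => hpt m s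
  have hM := C.M_cast_pos
  have hK := C.K_cast_pos
  have hmul := mul_le_mul_of_nonneg_left hsum (a := 1 / ((C.M : ℝ) * C.K)) (by positivity)
  simp only [Finset.sum_sub_distrib, Finset.sum_const, Finset.card_univ, Fintype.card_fin,
    nsmul_eq_mul, mul_sub] at hmul
  have hMK : 1 / ((C.M : ℝ) * C.K) * (C.M * (C.K * G)) = G := by field_simp
  rw [hMK] at hmul
  have := C.channelLaw_sub_le_wardenDistance hN (measurableSet_highEnergy N τ n)
  simp only [lowPowerFraction]
  linarith

/-- Averaging over the keys: the best key does at least as well as the mean. -/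
lemma exists_key_low_power {P f : ℝ} (hF : f ≤ C.lowPowerFraction P) :
    ∃ s, f * C.M ≤ ∑ m, if ∑ i, C.encode m s i ^ 2 ≤ P then (1 : ℝ) else 0 := by
  have hM := C.M_cast_pos
  have hK := C.K_cast_pos
  have : Nonempty (Fin C.K) := ⟨⟨0, C.K_pos⟩⟩
  have hle : ∑ _s : Fin C.K, f * C.M
      ≤ ∑ s, ∑ m, if ∑ i, C.encode m s i ^ 2 ≤ P then (1 : ℝ) else 0 := by
    rw [Finset.sum_comm, Finset.sum_const, Finset.card_univ, Fintype.card_fin, nsmul_eq_mul]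
    rw [lowPowerFraction, one_div, ← div_eq_inv_mul, le_div_iff₀ (by positivity)] at hF
    linarith
  obtain ⟨s, -, hs⟩ := Finset.exists_le_of_sum_le Finset.univ_nonempty hle
  exact ⟨s, hs⟩

lemma activeError_le_errorProb (Nb : ℝ) (s : Fin C.K) : C.activeError Nb s ≤ C.errorProb Nb := by
  have h1 : C.activeError Nb s ≤ ⨆ s, C.activeError Nb s :=
    le_ciSup (Set.finite_range _).bddAbove s
  have h2 : 0 ≤ C.silentError Nb :=
    mul_nonneg (by positivity) (Finset.sum_nonneg fun _ _ => measureReal_nonneg)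
  unfold errorProb
  linarith

lemma sum_channelLaw_decode_le_one (N : ℝ) (x : Fin n → ℝ) (s : Fin C.K) :
    ∑ m : Fin C.M, (channelLaw N x).real {y | C.decode y s = m.succ} ≤ 1 := by
  rw [← measureReal_biUnion_finset]
  · exact measureReal_le_one
  · intro m _ m' _ hmm
    refine Set.disjoint_left.2 fun y hy hy' => hmm ?_
    exact Fin.succ_injective _ (Eq.trans (Eq.symm hy) hy')
  · exact fun m _ => C.measurable_decode s (measurableSet_singleton _)

/-- A reliable code with a positive fraction of low-power codewords has few messages. -/
lemma log_M_le {N P t f : ℝ} (hN : 0 < N) (hf : 0 < f) (ht : 0 < t)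
    (hPt : 2 * P / (N * t ^ 2) ≤ 1 / 4) (hF : f ≤ C.lowPowerFraction P)
    (herr : C.errorProb N ≤ f / 4) : Real.log C.M ≤ Real.log (8 / f) + (P / N + t) := by
  obtain ⟨s, hs⟩ := C.exists_key_low_power hF
  have hM := C.M_cast_pos
  have herrs := (C.activeError_le_errorProb N s).trans herr
  rw [activeError, one_div, ← div_eq_inv_mul, div_le_iff₀ hM] at herrs
  set g := 1 / 4 * Real.exp (-(P / N + t)) with hg
  have hg0 : 0 < g := by positivity
  have hmeas : ∀ m : Fin C.M, MeasurableSet {y | C.decode y s = m.succ} := fun m =>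
    C.measurable_decode s (measurableSet_singleton _)
  -- The bracket is at most `1`, and nonpositive unless the word has low power and error at most
  -- `1/2`. Summed over `m`, the penalty is at most `f M / 2`, leaving at least `f M / 2` of the `f
  -- M` low-power words.
  have hpt : ∀ m, g * ((if ∑ i, C.encode m s i ^ 2 ≤ P then (1 : ℝ) else 0)
      - 2 * (channelLaw N (C.encode m s)).real {y | C.decode y s ≠ m.succ})
      ≤ (channelLaw N 0).real {y | C.decode y s = m.succ} := by
    intro m
    have he : 0 ≤ (channelLaw N (C.encode m s)).real {y | C.decode y s ≠ m.succ} :=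
      measureReal_nonneg
    have hcompl : (channelLaw N (C.encode m s)).real {y | C.decode y s ≠ m.succ}
        = 1 - (channelLaw N (C.encode m s)).real {y | C.decode y s = m.succ} :=
      probReal_compl_eq_one_sub (hmeas m)
    by_cases h : ∑ i, C.encode m s i ^ 2 ≤ P ∧
        (channelLaw N (C.encode m s)).real {y | C.decode y s ≠ m.succ} ≤ 1 / 2
    · refine le_trans ?_ (exp_le_channelLaw_zero_real hN h.1 ht hPt (hmeas m) (by linarith [h.2]))
      rw [if_pos h.1]
      exact mul_le_of_le_one_right hg0.le (by linarith)
    · refine le_trans (mul_nonpos_of_nonneg_of_nonpos hg0.le ?_) measureReal_nonneg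
      rw [not_and_or, not_le, not_le] at h
      rcases h with h | h
      · rw [if_neg (not_le.2 h)]; linarith
      · split_ifs <;> linarith
  have hsum := (Finset.sum_le_sum fun m (_ : m ∈ Finset.univ) => hpt m).trans
    (C.sum_channelLaw_decode_le_one N 0 s)
  rw [← Finset.mul_sum, Finset.sum_sub_distrib, ← Finset.mul_sum] at hsum
  have hbound : g * (f / 2 * C.M) ≤ 1 :=
    (mul_le_mul_of_nonneg_left (by linarith) hg0.le).trans hsum
  have hMle : (C.M : ℝ) ≤ 8 / f * Real.exp (P / N + t) := by
    have hee : Real.exp (-(P / N + t)) * Real.exp (P / N + t) = 1 := by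
      rw [← Real.exp_add, neg_add_cancel, Real.exp_zero]
    have := mul_le_mul_of_nonneg_right hbound (Real.exp_pos (P / N + t)).le
    have h8 : g * (f / 2 * C.M) * Real.exp (P / N + t) = f / 8 * C.M := by
      rw [hg]; linear_combination (f / 8 * C.M) * hee
    rw [h8, one_mul] at this
    rw [div_mul_eq_mul_div, le_div_iff₀ hf]
    linarith
  calc Real.log C.M ≤ Real.log (8 / f * Real.exp (P / N + t)) := Real.log_le_log hM hMle
    _ = _ := by rw [Real.log_mul (by positivity) (Real.exp_pos _).ne', Real.log_exp]

end Code

/-! ### Asymptotics -/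

/-- Codes that satisfy the covertness constraint eventually have a non-vanishing fraction of
codewords with energy below any multiple of `√n` larger than the critical one. -/
lemma exists_eventually_le_lowPowerFraction {N δ r₀ r : ℝ} (hN : 0 < N) (hr₀ : 0 < r₀)
    (hr : r₀ < r) (hQ : Q r₀ < (1 - δ) / 2) (C : ∀ n : ℕ, Code n)
    (hcovert : limsup (fun n => (((C n).wardenDistance N : ℝ) : EReal)) atTop ≤ (δ : EReal)) :
    ∃ f > 0, ∀ᶠ n in atTop, f ≤ (C n).lowPowerFraction (√2 * N * r * √n) := by
  set v := √2 * (N / 2) with hv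
  have hv0 : 0 < v := by positivity
  have hlow := tendsto_channelLaw_zero_real_energy_gt hN (-(v * r₀))
  have hhigh := tendsto_channelLaw_zero_real_energy_gt hN (v * r₀)
  rw [← hv, neg_div, mul_div_cancel_left₀ _ hv0.ne', Q_neg] at hlow
  rw [← hv, mul_div_cancel_left₀ _ hv0.ne'] at hhigh
  -- `κ` is the limiting slack. The distance uses `κ/4` and the three other limits `κ/8` each,
  -- leaving `3κ/8 ≥ κ/4`.
  set κ := 1 - 2 * Q r₀ - δ with hκ
  have hκ0 : 0 < κ := by linarith
  have hβ : √2 * N * r = 2 * (v * r) := by rw [hv]; ring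
  have hτβ : 2 * (v * r₀) < √2 * N * r := by rw [hβ]; gcongr
  set c := (1 - 2 * (v * r₀) / (√2 * N * r)) ^ 2 * (√2 * N * r)
  have hsmall : Tendsto (fun n : ℕ => 2 * N / (c * √n)) atTop (𝓝 0) := by
    have : Tendsto (fun n : ℕ => 2 * N / c / √(n : ℝ)) atTop (𝓝 0) :=
      tendsto_const_nhds.div_atTop (Real.tendsto_sqrt_atTop.comp tendsto_natCast_atTop_atTop)
    simpa only [div_div] using this
  have hV : ∀ᶠ n in atTop, (((C n).wardenDistance N : ℝ) : EReal) < ((δ + κ / 4 : ℝ) : EReal) :=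
    eventually_lt_of_limsup_lt (hcovert.trans_lt (EReal.coe_lt_coe_iff.2 (by linarith)))
  refine ⟨κ / 4, by positivity, ?_⟩
  filter_upwards [hV, hsmall.eventually (gt_mem_nhds (show 0 < κ / 8 by positivity)),
    hlow.eventually (lt_mem_nhds (show 1 - Q r₀ - κ / 8 < 1 - Q r₀ by linarith)),
    hhigh.eventually (gt_mem_nhds (show Q r₀ < Q r₀ + κ / 8 by linarith)),
    eventually_gt_atTop 0] with n h1 h2 h3 h4 hn
  rw [EReal.coe_lt_coe_iff] at h1
  have := (C n).sub_wardenDistance_le_lowPowerFraction hN hn (mul_pos hv0 hr₀) hτβ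
  unfold highEnergy at this
  linarith

end CovertGaussian

open CovertGaussian in
theorem theorem2 (Nw Nb δ : ℝ) (hNw : 0 < Nw) (hNb : 0 < Nb) (hδ : δ ∈ Set.Ioo (0 : ℝ) 1)
    (C : ∀ n : ℕ, CovertGaussian.Code n)
    (hreliable : Filter.Tendsto (fun n => (C n).errorProb Nb) Filter.atTop (nhds 0))
    (hcovert : Filter.limsup (fun n => (((C n).wardenDistance Nw : ℝ) : EReal)) Filter.atTop
      ≤ (δ : EReal)) :
    Filter.limsup (fun n : ℕ => ((Real.log ((C n).M : ℝ) / Real.sqrt (n : ℝ) : ℝ) : EReal))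
        Filter.atTop
      ≤ ((Real.sqrt 2 * Nw / Nb * CovertGaussian.Qinv ((1 - δ) / 2) : ℝ) : EReal) := by
  obtain ⟨hδ0, hδ1⟩ := hδ
  set q := Qinv ((1 - δ) / 2) with hq
  have hQq : Q q = (1 - δ) / 2 := Q_Qinv ⟨by linarith, by linarith⟩
  have hq0 : 0 < q := by
    refine Q_strictAnti.lt_iff_gt.1 ?_
    have := Q_neg 0
    rw [neg_zero] at this
    linarith
  set a := √2 * Nw / Nb with ha
  have ha0 : 0 < a := by positivity
  refine EReal.le_of_forall_lt_iff_le.1 fun z hz => ?_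
  rw [EReal.coe_lt_coe_iff, mul_comm, ← lt_div_iff₀ ha0] at hz
  -- `q < r₀` makes the detector beat `δ`, `r₀ < r` gives `2τ < β`, and `r < z/a` leaves room for
  -- the lower-order terms.
  obtain ⟨r, hqr, hrz⟩ := exists_between hz
  obtain ⟨r₀, hqr₀, hr₀r⟩ := exists_between hqr
  rw [lt_div_iff₀ ha0] at hrz
  obtain ⟨f, hf, hlow⟩ := exists_eventually_le_lowPowerFraction hNw (hq0.trans hqr₀) hr₀r
    (hQq ▸ Q_strictAnti hqr₀) C hcovert
  -- Half of the slack pays for the deviation `t = η√n`, half for `log (8/f)`.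
  set η := (z - r * a) / 2 with hη
  have hη0 : 0 < η := by linarith
  have hsqrt : Tendsto (fun n : ℕ => √(n : ℝ)) atTop atTop :=
    Real.tendsto_sqrt_atTop.comp tendsto_natCast_atTop_atTop
  have h1 : Tendsto (fun n : ℕ => 2 * (√2 * Nw * r) / (Nb * η ^ 2) / √(n : ℝ)) atTop (𝓝 0) :=
    tendsto_const_nhds.div_atTop hsqrt
  have h2 : Tendsto (fun n : ℕ => Real.log (8 / f) / √(n : ℝ)) atTop (𝓝 0) :=
    tendsto_const_nhds.div_atTop hsqrt
  refine limsup_le_of_le (by isBoundedDefault) ?_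
  filter_upwards [hlow, h1.eventually (gt_mem_nhds (show (0 : ℝ) < 1 / 4 by norm_num)),
    h2.eventually (gt_mem_nhds hη0), hsqrt.eventually_gt_atTop 0,
    hreliable.eventually (gt_mem_nhds (show 0 < f / 4 by positivity))] with n hF h1 h2 hn herr
  rw [EReal.coe_le_coe_iff, div_le_iff₀ hn]
  -- With both `P` and `t` of order `√n`, the Chebyshev ratio `P/t²` is of order `1/√n`.
  have hPt : 2 * (√2 * Nw * r * √n) / (Nb * (η * √n) ^ 2) ≤ 1 / 4 := by
    refine le_trans (le_of_eq ?_) h1.le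
    field_simp
  refine ((C n).log_M_le hNb hf (mul_pos hη0 hn) hPt hF herr.le).trans ?_
  rw [div_lt_iff₀ hn] at h2
  have hP : √2 * Nw * r * √n / Nb = r * a * √n := by rw [ha]; ring
  have hz' : z * √(n : ℝ) = r * a * √n + 2 * (η * √n) := by rw [hη]; ring
  rw [hP, hz']
  linarith
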